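/- Let $(X,\|\cdot\|)$ be a Banach space, $a<b$ real, $f\in C^1([a,b],X)$, $0<\beta<1$, $m\in\mathbb N=\{1,2,\dots\}$, and let $n\in\mathbb N$ satisfy $n^{1-\beta}>2$ and $\lceil na\rceil\le\lfloor nb\rfloor$. Put $$\varphi(x)=\frac{x}{\sqrt[2m]{1+x^{2m}}},\qquad \Phi(x)=\tfrac14\bigl[\varphi(x+1)-\varphi(x-1)\bigr],\qquad A_n(f,x)=\frac{\sum_{k=\lceil na\rceil}^{\lfloor nb\rfloor}f(k/n)\,\Phi(nx-k)}{\sum_{k=\lceil na\rceil}^{\lfloor nb\rfloor}\Phi(nx-k)}\quad(x\in[a,b]).$$ For $x\in[a,b]$ let $$D_{*x}^{1/2}f(y)=\frac1{\Gamma(1/2)}\int_x^y (y-t)^{-1/2}f'(t)\,dt\ \ (y\in[x,b]),\qquad D_{x-}^{1/2}f(y)=\frac{-1}{\Gamma(1/2)}\int_y^x (z-y)^{-1/2}f'(z)\,dz\ \ (y\in[a,x])$$ be the left and right Caputo derivatives of order $\tfrac12$ (Bochner integrals). For $g$ defined on an interval $I$ let $\omega_1(g,\delta)_I=\sup\{\|g(y)-g(z)\|: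 y,z\in I,\ |y-z|\le\delta\}$ and $\|g\|_{\infty,I}=\sup_{y\in I}\|g(y)\|$, and write $\|\cdot\|_\infty=\|\cdot\|_{\infty,[a,b]}$. Then: i) for every $x\in[a,b]$, $$\|A_n(f,x)-f(x)\|\le\frac{4\sqrt[2m]{1+4^m}}{\sqrt\pi}\left\{\frac{\omega_1\bigl(D_{x-}^{1/2}f,\frac1{n^\beta}\bigr)_{[a,x]}+\omega_1\bigl(D_{*x}^{1/2}f,\frac1{n^\beta}\bigr)_{[x,b]}}{n^{\beta/2}}+\frac{\|D_{x-}^{1/2}f\|_{\infty,[a,x]}\sqrt{x-a}+\|D_{*x}^{1/2}f\|_{\infty,[x,b]}\sqrt{b-x}}{4m\,(n^{1-\beta}-2)^{2m}}\right\};$$ ii) $$\|A_nf-f\|_\infty\le\frac{4\sqrt[2m]{1+4^m}}{\sqrt\pi}\left\{\frac{\sup_{x\in[a,b]}\omega_1\bigl(D_{x-}^{1/2}f,\frac1{n^\beta}\bigr)_{[a,x]}+\sup_{x\in[a,b]}\omega_1\bigl(D_{*x}^{1/2}f,\frac1{n^\beta}\bigr)_{[x,b]}}{n^{\beta/2}}+\frac{\sqrt{b-a}}{4m\,(n^{1-\beta}-2)^{2m}}\Bigl(\sup_{x\in[a,b]}\|D_{x-}^{1/2}f\|_{\infty,[a,x]}+\sup_{x\in[a,b]}\|D_{*x}^{1/2}f\|_{\infty,[x,b]}\Bigr)\right\}<\infty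 .$$ -/

import Mathlib

open scoped ENNReal

namespace NeuralFrac

/-- The algebraic sigmoidal function `φ(x) = x / (1 + x^(2m))^(1/(2m))`. -/
noncomputable def sigmoid (m : ℕ) (x : ℝ) : ℝ :=
  x / (1 + x ^ (2 * m)) ^ (1 / (2 * (m : ℝ)))

/-- The activation (density) function `Φ(x) = (φ(x+1) - φ(x-1)) / 4`. -/
noncomputable def density (m : ℕ) (x : ℝ) : ℝ :=
  (1 / 4) * (sigmoid m (x + 1) - sigmoid m (x - 1))

variable {X : Type*} [NormedAddCommGroup X] [NormedSpace ℝ X]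

/-- The normalized `X`-valued neural network operator `A_n(f, x)` on `[a, b]`; it is meaningful
when `⌈na⌉ ≤ ⌊nb⌋`. -/
noncomputable def netOp (m : ℕ) (a b : ℝ) (n : ℕ) (f : ℝ → X) (x : ℝ) : X :=
  (∑ k ∈ Finset.Icc ⌈(n : ℝ) * a⌉ ⌊(n : ℝ) * b⌋, density m ((n : ℝ) * x - (k : ℝ)))⁻¹ •
    ∑ k ∈ Finset.Icc ⌈(n : ℝ) * a⌉ ⌊(n : ℝ) * b⌋,
      density m ((n : ℝ) * x - (k : ℝ)) • f ((k : ℝ) / (n : ℝ))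

/-- The left Caputo-Bochner fractional derivative `(D_{*x₀}^α f)(x)` of order `α ≥ 0` with base
point `x₀`, for `f` on `[a, b]` and `x₀, x ∈ [a, b]`. It is set to be `0` for `x < x₀`, and it is
the ordinary derivative when `α` is a natural number. -/
noncomputable def caputoLeft (α a b : ℝ) (f : ℝ → X) (x₀ x : ℝ) : X :=
  if x < x₀ then 0
  else if α = (⌈α⌉₊ : ℝ) then iteratedDerivWithin ⌈α⌉₊ f (Set.Icc a b) x
  else (1 / Real.Gamma ((⌈α⌉₊ : ℝ) - α)) •
    ∫ t in x₀..x, (x - t) ^ ((⌈α⌉₊ : ℝ) - α - 1) • iteratedDerivWithin ⌈α⌉₊ f (Set.Icc a b) t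

/-- The right Caputo-Bochner fractional derivative `(D_{x₀-}^α f)(x)` of order `α ≥ 0` with base
point `x₀`, for `f` on `[a, b]` and `x₀, x ∈ [a, b]`. It is set to be `0` for `x > x₀`, and it is
`(-1)^α` times the ordinary derivative when `α` is a natural number. -/
noncomputable def caputoRight (α a b : ℝ) (f : ℝ → X) (x₀ x : ℝ) : X :=
  if x₀ < x then 0
  else if α = (⌈α⌉₊ : ℝ) then
    ((-1 : ℝ) ^ ⌈α⌉₊) • iteratedDerivWithin ⌈α⌉₊ f (Set.Icc a b) x
  else ((-1 : ℝ) ^ ⌈α⌉₊ / Real.Gamma ((⌈α⌉₊ : ℝ) - α)) •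
    ∫ z in x..x₀, (z - x) ^ ((⌈α⌉₊ : ℝ) - α - 1) • iteratedDerivWithin ⌈α⌉₊ f (Set.Icc a b) z

/-- The first modulus of continuity `ω₁(g, δ)_S`, as a supremum in `[0, ∞]`. -/
noncomputable def modulus (g : ℝ → X) (δ : ℝ) (S : Set ℝ) : ℝ≥0∞ :=
  ⨆ y ∈ S, ⨆ z ∈ S, ⨆ _ : |y - z| ≤ δ, ‖g y - g z‖ₑ

/-- The supremum norm `‖g‖_{∞, S}`, as a supremum in `[0, ∞]`. -/
noncomputable def supNorm (g : ℝ → X) (S : Set ℝ) : ℝ≥0∞ :=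
  ⨆ y ∈ S, ‖g y‖ₑ

end NeuralFrac

/-! Since `density` is nonnegative, `A_n(f,x) - f(x)` is a weighted average of the differences
`f(k/n) - f(x)`. The total weight is at most 1 by telescoping, and at least `1/C` with `C =
2(1+4^m)^(1/(2m))`, because some node `k` lies within distance 1 of `nx`. So the error is at most
`C` times the weighted sum of `‖f(k/n) - f(x)‖`.

Each difference is controlled by a fractional Taylor formula: composing two Abel operators of order
1/2 gives `π` times ordinary integration, so `f` is recovered from its Caputo derivative. Hence
`‖f(y) - f(x)‖ ≤ (2/√π) M √|y-x|` whenever `M` bounds the derivative based at `x` between `x` and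
`y`.

For nodes with `|k/n - x| ≤ n^(-β)`, take `M` to be the modulus of continuity: this is allowed
because the Caputo derivative vanishes at its base point. For the other nodes take `M` to be the sup
norm; their weight on each side is at most `1/(4m(N-2)^(2m))`, where `N = n^(1-β)`, by Bernoulli's
inequality for the tail of the sigmoid. The product `C · 2/√π` is the constant of the theorem. The
uniform bound follows by taking suprema, and is finite because `f'` is bounded on `[a,b]`. -/

namespace NeuralFrac

/-! ### Sigmoid, density, and sums of density weights. -/

section Sigmoid

variable {m : ℕ}

theorem sigmoid_neg (x : ℝ) : sigmoid m (-x) = -sigmoid m x := by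
  simp [sigmoid, neg_div, (even_two_mul m).neg_pow]

/-- Dividing through by `x` makes both the monotonicity and the limit 1 at infinity visible. -/
theorem sigmoid_of_pos (hm : 1 ≤ m) {x : ℝ} (hx : 0 < x) :
    sigmoid m x = 1 / (1 + (x ^ (2 * m))⁻¹) ^ (1 / (2 * (m : ℝ))) := by
  have hp : 0 < x ^ (2 * m) := by positivity
  have hx' : (x ^ (2 * m)) ^ (1 / (2 * (m : ℝ))) = x := by
    have := Real.pow_rpow_inv_natCast hx.le (n := 2 * m) (by omega)
    push_cast at this
    rwa [one_div]
  have h : 1 + x ^ (2 * m) = x ^ (2 * m) * (1 + (x ^ (2 * m))⁻¹) := by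
    field_simp; ring
  rw [sigmoid, h, Real.mul_rpow hp.le (by positivity), hx']
  field_simp

theorem sigmoid_zero : sigmoid m 0 = 0 := by simp [sigmoid]

theorem sigmoid_nonneg {x : ℝ} (hx : 0 ≤ x) : 0 ≤ sigmoid m x := by
  unfold sigmoid; positivity

theorem monotone_sigmoid (hm : 1 ≤ m) : Monotone (sigmoid m) := by
  refine monotone_of_odd_of_monotoneOn_nonneg sigmoid_neg fun x hx y hy hxy => ?_
  rcases (Set.mem_Ici.1 hx).eq_or_lt with rfl | hx0
  · rw [sigmoid_zero]; exact sigmoid_nonneg hxy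
  · rw [sigmoid_of_pos hm hx0, sigmoid_of_pos hm (hx0.trans_le hxy)]
    have hy0 : 0 < y := hx0.trans_le hxy
    have h1 : 0 < (1 + (y ^ (2 * m))⁻¹) ^ (1 / (2 * (m : ℝ))) := by positivity
    have h2 : 0 ≤ 1 + (y ^ (2 * m))⁻¹ := by positivity
    gcongr

theorem sigmoid_le_one (hm : 1 ≤ m) (x : ℝ) : sigmoid m x ≤ 1 := by
  rcases le_or_gt x 0 with hx | hx
  · exact (monotone_sigmoid hm hx).trans (by simp [sigmoid_zero])
  · rw [sigmoid_of_pos hm hx]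
    refine (div_le_one (by positivity)).2 (Real.one_le_rpow ?_ (by positivity))
    simpa using by positivity

theorem neg_one_le_sigmoid (hm : 1 ≤ m) (x : ℝ) : -1 ≤ sigmoid m x := by
  have := sigmoid_le_one hm (-x)
  rw [sigmoid_neg] at this
  linarith

/-- Bernoulli's inequality for the exponent `1/(2m) ≤ 1`, with `u = x^(-2m)`, followed by `1/(1+v) ≥
1 - v`. -/
theorem one_sub_sigmoid_le (hm : 1 ≤ m) {x : ℝ} (hx : 0 < x) :
    1 - sigmoid m x ≤ 1 / (2 * m * x ^ (2 * m)) := by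
  have hm' : (1 : ℝ) ≤ m := by exact_mod_cast hm
  set u := (x ^ (2 * m))⁻¹ with hu
  have hu0 : 0 < u := by positivity
  have hB : (1 + u) ^ (1 / (2 * (m : ℝ))) ≤ 1 + 1 / (2 * (m : ℝ)) * u :=
    rpow_one_add_le_one_add_mul_self (by linarith) (by positivity)
      ((div_le_one (by positivity)).2 (by linarith))
  have hs : 1 / (1 + 1 / (2 * (m : ℝ)) * u) ≤ sigmoid m x := by
    rw [sigmoid_of_pos hm hx]
    gcongr
  have hr : 1 / (2 * m * x ^ (2 * m)) = 1 / (2 * (m : ℝ)) * u := by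
    rw [hu]; field_simp
  rw [hr]
  set v := 1 / (2 * (m : ℝ)) * u
  have hv : 0 < v := by positivity
  have : 1 - v ≤ 1 / (1 + v) := by
    rw [le_div_iff₀ (by linarith)]; nlinarith
  linarith

/-- The denominator increases on the half-line, so replacing it at `x + y` by its value at `x` or at
`y` only enlarges each fraction. -/
theorem sigmoid_add_le {x y : ℝ} (hx : 0 ≤ x) (hy : 0 ≤ y) :
    sigmoid m (x + y) ≤ sigmoid m x + sigmoid m y := by
  unfold sigmoid
  rw [add_div]
  gcongr
  · linarith
  · linarith

theorem sigmoid_two :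
    sigmoid m 2 = 2 / (1 + 4 ^ m : ℝ) ^ (1 / (2 * (m : ℝ))) := by
  rw [sigmoid, pow_mul]; norm_num

theorem density_nonneg (hm : 1 ≤ m) (x : ℝ) : 0 ≤ density m x := by
  have := monotone_sigmoid hm (show x - 1 ≤ x + 1 by linarith)
  unfold density; linarith

/-- By oddness the difference in `density` is `φ(1+x) + φ(1-x)`, which is at least `φ(2)` by
subadditivity. This is the source of the factor `(1+4^m)^(1/(2m))`. -/
theorem le_density_of_abs_le_one {x : ℝ} (hx : |x| ≤ 1) :
    1 / (2 * (1 + 4 ^ m : ℝ) ^ (1 / (2 * (m : ℝ)))) ≤ density m x := by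
  obtain ⟨h1, h2⟩ := abs_le.1 hx
  have h := sigmoid_add_le (m := m) (show 0 ≤ x + 1 by linarith) (show 0 ≤ 1 - x by linarith)
  rw [show x + 1 + (1 - x) = 2 by ring, sigmoid_two, show 1 - x = -(x - 1) by ring,
    sigmoid_neg] at h
  have e : 1 / (2 * (1 + 4 ^ m : ℝ) ^ (1 / (2 * (m : ℝ)))) =
      1 / 4 * (2 / (1 + 4 ^ m : ℝ) ^ (1 / (2 * (m : ℝ)))) := by
    field_simp; norm_num
  rw [e, density]
  linarith

/-- The sum telescopes with step 2, which leaves two boundary terms at each end. -/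
theorem sum_density_Ico (c : ℝ) (p : ℤ) (r : ℕ) :
    ∑ k ∈ Finset.Ico p (p + r), density m (c - k) =
      (sigmoid m (c - p + 1) + sigmoid m (c - p) -
        sigmoid m (c - (p + r) + 1) - sigmoid m (c - (p + r))) / 4 := by
  induction r with
  | zero => simp
  | succ r ih =>
    have h : Finset.Ico p (p + (r + 1 : ℕ)) = insert (p + (r : ℤ)) (Finset.Ico p (p + r)) := by
      ext k; simp only [Finset.mem_insert, Finset.mem_Ico]; push_cast; omega
    rw [h, Finset.sum_insert (by simp), ih, density]
    push_cast
    rw [show c - (p + (r + 1)) + 1 = c - (p + r) by ring,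
      show c - (p + (r + 1)) = c - (p + r) - 1 by ring]
    ring

/-- Nonnegativity allows enlarging `S` to the full integer interval. It serves both the total mass
and the tails. -/
theorem sum_density_le (hm : 1 ≤ m) (c : ℝ) {p q : ℤ} (hpq : p ≤ q) {S : Finset ℤ}
    (hS : ∀ k ∈ S, p ≤ k ∧ k ≤ q) :
    ∑ k ∈ S, density m (c - k) ≤
      (sigmoid m (c - p + 1) + sigmoid m (c - p) -
        sigmoid m (c - q) - sigmoid m (c - q - 1)) / 4 := by
  have hr : p + ((q + 1 - p).toNat : ℤ) = q + 1 := by omega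
  have hr' : (p : ℝ) + ((q + 1 - p).toNat : ℝ) = q + 1 := by exact_mod_cast hr
  have h := sum_density_Ico (m := m) c p (q + 1 - p).toNat
  rw [hr, hr', show c - ((q : ℝ) + 1) + 1 = c - q by ring,
    show c - ((q : ℝ) + 1) = c - q - 1 by ring] at h
  rw [← h]
  refine Finset.sum_le_sum_of_subset_of_nonneg (fun k hk => ?_) fun _ _ _ => density_nonneg hm _
  have := hS k hk
  rw [Finset.mem_Ico]; omega

theorem sum_density_le_one (hm : 1 ≤ m) (c : ℝ) (p q : ℤ) :
    ∑ k ∈ Finset.Icc p q, density m (c - k) ≤ 1 := by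
  rcases le_or_gt p q with h | h
  · refine (sum_density_le hm c h fun k hk => Finset.mem_Icc.1 hk).trans ?_
    linarith [sigmoid_le_one hm (c - p + 1), sigmoid_le_one hm (c - p),
      neg_one_le_sigmoid hm (c - q), neg_one_le_sigmoid hm (c - q - 1)]
  · simp [Finset.Icc_eq_empty_of_lt h]

theorem one_sub_sigmoid_div_two_le (hm : 1 ≤ m) {N x : ℝ} (hN : 2 < N) (hx : N - 1 ≤ x) :
    (1 - sigmoid m x) / 2 ≤ 1 / (4 * m * (N - 2) ^ (2 * m)) := by
  have h1 := one_sub_sigmoid_le hm (show 0 < x by linarith)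
  have h2 : 1 / (2 * (m : ℝ) * x ^ (2 * m)) ≤ 1 / (2 * m * (N - 2) ^ (2 * m)) := by
    have h0 : 0 < N - 2 := by linarith
    have hm' : (0 : ℝ) < m := by exact_mod_cast hm
    gcongr
    linarith
  have h3 : 1 / (4 * m * (N - 2) ^ (2 * m)) = 1 / (2 * (m : ℝ) * (N - 2) ^ (2 * m)) / 2 := by
    field_simp; norm_num
  rw [h3]; linarith

theorem tail_nonneg {N : ℝ} (hN : 2 < N) : 0 ≤ 1 / (4 * (m : ℝ) * (N - 2) ^ (2 * m)) := by
  have h0 : 0 < N - 2 := by linarith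
  positivity

/-- After telescoping, the far boundary terms are at most 1, and the near ones have arguments at
least `N - 1`, so the sum is at most `(1 - φ(c - ⌊c-N⌋ - 1))/2`. -/
theorem sum_density_left_tail_le (hm : 1 ≤ m) (c : ℝ) (p q : ℤ) {N : ℝ} (hN : 2 < N) :
    ∑ k ∈ Finset.Icc p q with N < c - (k : ℤ), density m (c - k) ≤
      1 / (4 * m * (N - 2) ^ (2 * m)) := by
  rcases (Finset.Icc p q |>.filter fun k : ℤ => N < c - k).eq_empty_or_nonempty with h | ⟨j, hj⟩
  · rw [h, Finset.sum_empty]; exact tail_nonneg hN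
  · have hk : ∀ k ∈ (Finset.Icc p q).filter (fun k : ℤ => N < c - k), p ≤ k ∧ k ≤ ⌊c - N⌋ := by
      intro k hk
      rw [Finset.mem_filter, Finset.mem_Icc] at hk
      exact ⟨hk.1.1, Int.le_floor.2 (by linarith [hk.2])⟩
    refine (sum_density_le hm c ((hk j hj).1.trans (hk j hj).2) hk).trans ?_
    have hf := Int.floor_le (c - N)
    refine le_trans ?_ (one_sub_sigmoid_div_two_le hm hN
      (show N - 1 ≤ c - ⌊c - N⌋ - 1 by linarith))
    linarith [sigmoid_le_one hm (c - p + 1), sigmoid_le_one hm (c - p),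
      monotone_sigmoid hm (show c - ⌊c - N⌋ - 1 ≤ c - ⌊c - N⌋ by linarith)]

theorem sum_density_right_tail_le (hm : 1 ≤ m) (c : ℝ) (p q : ℤ) {N : ℝ} (hN : 2 < N) :
    ∑ k ∈ Finset.Icc p q with N < (k : ℤ) - c, density m (c - k) ≤
      1 / (4 * m * (N - 2) ^ (2 * m)) := by
  rcases (Finset.Icc p q |>.filter fun k : ℤ => N < k - c).eq_empty_or_nonempty with h | ⟨j, hj⟩
  · rw [h, Finset.sum_empty]; exact tail_nonneg hN
  · have hk : ∀ k ∈ (Finset.Icc p q).filter (fun k : ℤ => N < k - c), ⌈c + N⌉ ≤ k ∧ k ≤ q := by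
      intro k hk
      rw [Finset.mem_filter, Finset.mem_Icc] at hk
      exact ⟨Int.ceil_le.2 (by linarith [hk.2]), hk.1.2⟩
    refine (sum_density_le hm c ((hk j hj).1.trans (hk j hj).2) hk).trans ?_
    have hf := Int.le_ceil (c + N)
    refine le_trans ?_ (one_sub_sigmoid_div_two_le hm hN
      (show N - 1 ≤ -(c - ⌈c + N⌉ + 1) by linarith))
    rw [sigmoid_neg]
    linarith [neg_one_le_sigmoid hm (c - q), neg_one_le_sigmoid hm (c - q - 1),
      monotone_sigmoid hm (show c - (⌈c + N⌉ : ℝ) ≤ c - ⌈c + N⌉ + 1 by linarith)]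

/-- A single node within distance 1 of `c` suffices: `⌊c⌋` if it lies in the range, otherwise the
nearer end of the range. -/
theorem le_sum_density (hm : 1 ≤ m) {c : ℝ} {p q : ℤ} (hpq : p ≤ q)
    (hp : p - 1 ≤ c) (hq : c ≤ q + 1) :
    1 / (2 * (1 + 4 ^ m : ℝ) ^ (1 / (2 * (m : ℝ)))) ≤
      ∑ k ∈ Finset.Icc p q, density m (c - k) := by
  obtain ⟨j, hj, hjc⟩ : ∃ j ∈ Finset.Icc p q, |c - (j : ℤ)| ≤ 1 := by
    have h1 := Int.floor_le c
    have h2 := Int.lt_floor_add_one c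
    simp only [Finset.mem_Icc, abs_le]
    rcases lt_or_ge ⌊c⌋ p with h | h
    · have : (⌊c⌋ : ℝ) + 1 ≤ p := by exact_mod_cast h
      exact ⟨p, ⟨le_rfl, hpq⟩, by linarith, by linarith⟩
    · rcases le_or_gt ⌊c⌋ q with h' | h'
      · exact ⟨⌊c⌋, ⟨h, h'⟩, by linarith, by linarith⟩
      · have : (q : ℝ) + 1 ≤ ⌊c⌋ := by exact_mod_cast h'
        exact ⟨q, ⟨hpq, le_rfl⟩, by linarith, by linarith⟩
  exact (le_density_of_abs_le_one hjc).trans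
    (Finset.single_le_sum (f := fun k : ℤ => density m (c - k))
      (fun _ _ => density_nonneg hm _) hj)

end Sigmoid

end NeuralFrac

namespace NeuralFrac

/-! ### Abel integral operators of order one half. -/

section Abel

open MeasureTheory

/-- The affine map carries `[s, y]` to `[-1, 1]`. This explicit primitive yields both integrability
of the doubly singular kernel and the value `B(1/2, 1/2) = π`. -/
theorem hasDerivAt_arcsin_affine {s y t : ℝ} (hst : s < t) (hty : t < y) :
    HasDerivAt (fun t => Real.arcsin ((2 * t - s - y) / (y - s)))
      ((y - t) ^ (-(1 / 2) : ℝ) * (t - s) ^ (-(1 / 2) : ℝ)) t := by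
  have h1 : 0 < t - s := by linarith
  have h2 : 0 < y - t := by linarith
  have h3 : 0 < y - s := by linarith
  have hu : HasDerivAt (fun t : ℝ => (2 * t - s - y) / (y - s)) (2 / (y - s)) t := by
    simpa using ((((hasDerivAt_id t).const_mul 2).sub_const s).sub_const y).div_const (y - s)
  have hl : -1 < (2 * t - s - y) / (y - s) := by rw [lt_div_iff₀ h3]; linarith
  have hr : (2 * t - s - y) / (y - s) < 1 := by rw [div_lt_one h3]; linarith
  have h := (Real.hasDerivAt_arcsin hl.ne' hr.ne).comp t hu
  refine h.congr_deriv ?_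
  have e : 1 - ((2 * t - s - y) / (y - s)) ^ 2 = (2 / (y - s)) ^ 2 * ((y - t) * (t - s)) := by
    field_simp; ring
  rw [e, Real.sqrt_mul (by positivity), Real.sqrt_sq (by positivity), Real.sqrt_mul h2.le,
    Real.rpow_neg h2.le, Real.rpow_neg h1.le, ← Real.sqrt_eq_rpow, ← Real.sqrt_eq_rpow]
  have : 0 < √(y - t) := Real.sqrt_pos.2 h2
  have : 0 < √(t - s) := Real.sqrt_pos.2 h1
  field_simp

theorem intervalIntegrable_beta_half {s y : ℝ} (hsy : s < y) :
    IntervalIntegrable (fun t => (y - t) ^ (-(1 / 2) : ℝ) * (t - s) ^ (-(1 / 2) : ℝ))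
      volume s y := by
  rw [intervalIntegrable_iff_integrableOn_Ioc_of_le hsy.le]
  refine intervalIntegral.integrableOn_deriv_of_nonneg
    (g := fun t => Real.arcsin ((2 * t - s - y) / (y - s)))
    (Real.continuous_arcsin.comp (by fun_prop)).continuousOn
    (fun t ht => hasDerivAt_arcsin_affine ht.1 ht.2) fun t ht => ?_
  have := sub_pos.2 ht.1
  have := sub_pos.2 ht.2
  positivity

theorem integral_beta_half {s y : ℝ} (hsy : s < y) :
    ∫ t in s..y, (y - t) ^ (-(1 / 2) : ℝ) * (t - s) ^ (-(1 / 2) : ℝ) = Real.pi := by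
  rw [intervalIntegral.integral_eq_sub_of_hasDerivAt_of_le hsy.le
    (f := fun t => Real.arcsin ((2 * t - s - y) / (y - s)))
    (Real.continuous_arcsin.comp (by fun_prop)).continuousOn
    (fun t ht => hasDerivAt_arcsin_affine ht.1 ht.2) (intervalIntegrable_beta_half hsy)]
  have h : y - s ≠ 0 := (sub_pos.2 hsy).ne'
  rw [show (2 * y - s - y) / (y - s) = 1 by field_simp; ring,
    show (2 * s - s - y) / (y - s) = -1 by field_simp; ring, Real.arcsin_neg, Real.arcsin_one]
  ring

variable {X : Type*} [NormedAddCommGroup X] [NormedSpace ℝ X]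

/-- The kernel obtained by composing two Abel operators of order one half. -/
noncomputable def abelKernel (y t s : ℝ) : ℝ :=
  if s < t then (y - t) ^ (-(1 / 2) : ℝ) * (t - s) ^ (-(1 / 2) : ℝ) else 0

theorem measurable_abelKernel (y : ℝ) :
    Measurable fun p : ℝ × ℝ => abelKernel y p.1 p.2 := by
  unfold abelKernel
  exact Measurable.ite (measurableSet_lt measurable_snd measurable_fst) (by fun_prop) (by fun_prop)

theorem abelKernel_nonneg {y t : ℝ} (s : ℝ) (h : t ≤ y) : 0 ≤ abelKernel y t s := by
  unfold abelKernel
  split_ifs with hst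
  · have := sub_nonneg.2 h
    have := sub_pos.2 hst
    positivity
  · exact le_rfl

theorem abelKernel_eq_indicator (y s : ℝ) :
    (fun t => abelKernel y t s) =
      (Set.Ioi s).indicator fun t => (y - t) ^ (-(1 / 2) : ℝ) * (t - s) ^ (-(1 / 2) : ℝ) := by
  ext t; simp [abelKernel, Set.indicator]

theorem integrableOn_abelKernel {x y s : ℝ} (hxs : x < s) (hsy : s ≤ y) :
    IntegrableOn (fun t => abelKernel y t s) (Set.Ioc x y) := by
  rw [abelKernel_eq_indicator, IntegrableOn, integrable_indicator_iff measurableSet_Ioi,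
    IntegrableOn, Measure.restrict_restrict measurableSet_Ioi, Set.inter_comm, Set.Ioc_inter_Ioi,
    sup_eq_right.2 hxs.le]
  rcases hsy.eq_or_lt with rfl | hsy
  · simp
  · exact (intervalIntegrable_iff_integrableOn_Ioc_of_le hsy.le).1 (intervalIntegrable_beta_half hsy)

theorem setIntegral_abelKernel {x y s : ℝ} (hxs : x < s) (hsy : s < y) :
    ∫ t in Set.Ioc x y, abelKernel y t s = Real.pi := by
  rw [abelKernel_eq_indicator, setIntegral_indicator measurableSet_Ioi, Set.Ioc_inter_Ioi,
    sup_eq_right.2 hxs.le, ← intervalIntegral.integral_of_le hsy.le, integral_beta_half hsy]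

theorem ae_restrict_Ioc_mem_Ioo (x y : ℝ) :
    ∀ᵐ s ∂volume.restrict (Set.Ioc x y), s ∈ Set.Ioo x y := by
  rw [← restrict_Ioo_eq_restrict_Ioc]
  exact ae_restrict_mem measurableSet_Ioo

/-- Integrating the norm in `t` first gives `π ‖g s‖`, so integrability of `g` is enough for Fubini.
-/
theorem integrable_abelKernel_smul {x y : ℝ} {g : ℝ → X}
    (hg : IntegrableOn g (Set.Ioc x y)) :
    Integrable (Function.uncurry fun t s => abelKernel y t s • g s)
      ((volume.restrict (Set.Ioc x y)).prod (volume.restrict (Set.Ioc x y))) := by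
  rw [integrable_prod_iff']
  · constructor
    · filter_upwards [ae_restrict_Ioc_mem_Ioo x y] with s hs
      exact (integrableOn_abelKernel hs.1 hs.2.le).smul_const (g s)
    · refine (hg.norm.const_mul Real.pi).congr ?_
      filter_upwards [ae_restrict_Ioc_mem_Ioo x y] with s hs
      have : ∀ t ∈ Set.Ioc x y, ‖abelKernel y t s • g s‖ = abelKernel y t s * ‖g s‖ := by
        intro t ht
        rw [norm_smul, Real.norm_of_nonneg (abelKernel_nonneg s ht.2)]
      simp only [Function.uncurry]
      rw [setIntegral_congr_fun measurableSet_Ioc this, integral_mul_const,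
        setIntegral_abelKernel hs.1 hs.2]
  · exact (measurable_abelKernel y).aestronglyMeasurable.smul hg.aestronglyMeasurable.comp_snd

/-- Inversion of the Abel operator of order one half. -/
theorem integral_abel_left [CompleteSpace X] {x y : ℝ} (hxy : x ≤ y) {g : ℝ → X}
    (hg : IntegrableOn g (Set.Ioc x y)) :
    ∫ t in x..y, (y - t) ^ (-(1 / 2) : ℝ) • ∫ s in x..t, (t - s) ^ (-(1 / 2) : ℝ) • g s =
      Real.pi • ∫ s in x..y, g s := by
  -- After the swap, the integral in `t` equals `π` for every `s` strictly between `x` and `y`.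
  have hF := integral_integral_swap (integrable_abelKernel_smul hg)
  rw [intervalIntegral.integral_of_le hxy, intervalIntegral.integral_of_le hxy, ← integral_smul]
  -- The cutoff `s < t` in the kernel turns the triangular domain into a square; the endpoint `s =
  -- t` is dropped as a null set.
  have hl : ∀ t ∈ Set.Ioc x y,
      (y - t) ^ (-(1 / 2) : ℝ) • ∫ s in x..t, (t - s) ^ (-(1 / 2) : ℝ) • g s =
        ∫ s in Set.Ioc x y, abelKernel y t s • g s := by
    intro t ht
    rw [← intervalIntegral.integral_smul, intervalIntegral.integral_of_le ht.1.le,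
      integral_Ioc_eq_integral_Ioo]
    have : (fun s => abelKernel y t s • g s) = (Set.Iio t).indicator fun s =>
        (y - t) ^ (-(1 / 2) : ℝ) • (t - s) ^ (-(1 / 2) : ℝ) • g s := by
      ext s; by_cases h : s < t <;> simp [abelKernel, Set.indicator, h, mul_smul]
    rw [this, setIntegral_indicator measurableSet_Iio]
    congr 2
    ext s
    simp only [Set.mem_Ioo, Set.mem_inter_iff, Set.mem_Ioc, Set.mem_Iio]
    exact ⟨fun h => ⟨⟨h.1, h.2.le.trans ht.2⟩, h.2⟩, fun h => ⟨h.1.1, h.2⟩⟩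
  rw [setIntegral_congr_fun measurableSet_Ioc hl, hF]
  refine integral_congr_ae ?_
  filter_upwards [ae_restrict_Ioc_mem_Ioo x y] with s hs
  rw [integral_smul_const, setIntegral_abelKernel hs.1 hs.2]

/-- Reflection `t ↦ -t` of the left-sided inversion. -/
theorem integral_abel_right [CompleteSpace X] {y x : ℝ} (hyx : y ≤ x) {g : ℝ → X}
    (hg : IntegrableOn g (Set.Icc y x)) :
    ∫ z in y..x, (z - y) ^ (-(1 / 2) : ℝ) • ∫ w in z..x, (w - z) ^ (-(1 / 2) : ℝ) • g w =
      Real.pi • ∫ w in y..x, g w := by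
  have hg' : IntegrableOn (fun s => g (-s)) (Set.Ioc (-x) (-y)) := by
    have h := hg.comp_neg
    rw [Set.neg_Icc] at h
    exact h.mono_set Set.Ioc_subset_Icc_self
  have h := integral_abel_left (neg_le_neg hyx) hg'
  rw [intervalIntegral.integral_comp_neg, neg_neg, neg_neg] at h
  rw [← h, ← neg_neg y, ← neg_neg x, ← intervalIntegral.integral_comp_neg, neg_neg, neg_neg]
  refine intervalIntegral.integral_congr fun t _ => ?_
  have e : ∫ w in -t..x, (w - -t) ^ (-(1 / 2) : ℝ) • g w =
      ∫ s in -x..t, (t - s) ^ (-(1 / 2) : ℝ) • g (-s) := by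
    rw [← neg_neg x, ← intervalIntegral.integral_comp_neg, neg_neg]
    refine intervalIntegral.integral_congr fun s _ => ?_
    rw [show -s - -t = t - s by ring]
  rw [e, show -t - y = -y - t by ring]

theorem integral_sub_rpow_neg_half (x y : ℝ) :
    ∫ t in x..y, (y - t) ^ (-(1 / 2) : ℝ) = 2 * √(y - x) := by
  rw [intervalIntegral.integral_comp_sub_left (fun u : ℝ => u ^ (-(1 / 2) : ℝ)) y, sub_self,
    integral_rpow (Or.inl (by norm_num)), Real.sqrt_eq_rpow]
  norm_num
  ring

theorem intervalIntegrable_sub_rpow_neg_half (x y : ℝ) :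
    IntervalIntegrable (fun t => (y - t) ^ (-(1 / 2) : ℝ)) volume x y := by
  have := (intervalIntegral.intervalIntegrable_rpow' (a := y - x) (b := 0)
    (show (-1 : ℝ) < -(1 / 2) by norm_num)).comp_sub_left y
  simpa using this

theorem norm_integral_sub_rpow_smul_le {x y M : ℝ} (hxy : x ≤ y) {h : ℝ → X}
    (hM : ∀ t ∈ Set.Icc x y, ‖h t‖ ≤ M) :
    ‖∫ t in x..y, (y - t) ^ (-(1 / 2) : ℝ) • h t‖ ≤ 2 * √(y - x) * M := by
  rw [← integral_sub_rpow_neg_half, ← intervalIntegral.integral_mul_const]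
  refine intervalIntegral.norm_integral_le_of_norm_le hxy (.of_forall fun t ht => ?_)
    ((intervalIntegrable_sub_rpow_neg_half x y).mul_const M)
  have h0 : 0 ≤ (y - t) ^ (-(1 / 2) : ℝ) := Real.rpow_nonneg (sub_nonneg.2 ht.2) _
  rw [norm_smul, Real.norm_of_nonneg h0]
  exact mul_le_mul_of_nonneg_left (hM t ⟨ht.1.le, ht.2⟩) h0

theorem norm_integral_rpow_sub_smul_le {y x M : ℝ} (hyx : y ≤ x) {h : ℝ → X}
    (hM : ∀ z ∈ Set.Icc y x, ‖h z‖ ≤ M) :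
    ‖∫ z in y..x, (z - y) ^ (-(1 / 2) : ℝ) • h z‖ ≤ 2 * √(x - y) * M := by
  have e := intervalIntegral.integral_comp_neg (a := -x) (b := -y)
    fun z => (z - y) ^ (-(1 / 2) : ℝ) • h z
  rw [neg_neg, neg_neg] at e
  rw [← e]
  have := norm_integral_sub_rpow_smul_le (neg_le_neg hyx) (h := fun t => h (-t)) (M := M)
    fun t ht => hM (-t) ⟨by linarith [ht.2], by linarith [ht.1]⟩
  rw [show -y - -x = x - y by ring] at this
  simpa only [show ∀ t : ℝ, -t - y = -y - t from fun t => by ring] using this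

end Abel

end NeuralFrac

namespace NeuralFrac

/-! ### Half-order Caputo derivatives and the fractional Taylor formula. -/

section Caputo

open MeasureTheory

variable {X : Type*} [NormedAddCommGroup X] [NormedSpace ℝ X]

theorem caputoLeft_half (a b : ℝ) (f : ℝ → X) {x y : ℝ} (hxy : x ≤ y) :
    caputoLeft (1 / 2) a b f x y =
      (1 / √Real.pi) • ∫ t in x..y, (y - t) ^ (-(1 / 2) : ℝ) • derivWithin f (Set.Icc a b) t := by
  have h1 : ⌈(1 / 2 : ℝ)⌉₊ = 1 := by rw [Nat.ceil_eq_iff one_ne_zero]; norm_num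
  rw [caputoLeft, if_neg hxy.not_gt, h1, if_neg (by norm_num), iteratedDerivWithin_one]
  norm_num
  rw [← Real.Gamma_one_half_eq]

theorem caputoRight_half (a b : ℝ) (f : ℝ → X) {x y : ℝ} (hyx : y ≤ x) :
    caputoRight (1 / 2) a b f x y =
      (-(1 / √Real.pi)) •
        ∫ z in y..x, (z - y) ^ (-(1 / 2) : ℝ) • derivWithin f (Set.Icc a b) z := by
  have h1 : ⌈(1 / 2 : ℝ)⌉₊ = 1 := by rw [Nat.ceil_eq_iff one_ne_zero]; norm_num
  rw [caputoRight, if_neg hyx.not_gt, h1, if_neg (by norm_num), iteratedDerivWithin_one]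
  norm_num
  rw [← Real.Gamma_one_half_eq, neg_div, neg_smul]
  norm_num

/-- Vanishing at the base point lets the modulus of continuity bound the size of the derivative near
`x`. -/
theorem caputoLeft_half_self (a b : ℝ) (f : ℝ → X) (x : ℝ) :
    caputoLeft (1 / 2) a b f x x = 0 := by
  rw [caputoLeft_half a b f le_rfl, intervalIntegral.integral_same, smul_zero]

theorem caputoRight_half_self (a b : ℝ) (f : ℝ → X) (x : ℝ) :
    caputoRight (1 / 2) a b f x x = 0 := by
  rw [caputoRight_half a b f le_rfl, intervalIntegral.integral_same, smul_zero]

theorem norm_caputoLeft_half_le {a b : ℝ} {f : ℝ → X} {G : ℝ}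
    (hG : ∀ t ∈ Set.Icc a b, ‖derivWithin f (Set.Icc a b) t‖ ≤ G) {x y : ℝ}
    (hax : a ≤ x) (hxy : x ≤ y) (hyb : y ≤ b) :
    ‖caputoLeft (1 / 2) a b f x y‖ ≤ 1 / √Real.pi * (2 * √(b - a) * G) := by
  have hG0 : 0 ≤ G := (norm_nonneg _).trans (hG x ⟨hax, hxy.trans hyb⟩)
  rw [caputoLeft_half a b f hxy, norm_smul, Real.norm_of_nonneg (by positivity)]
  gcongr
  refine (norm_integral_sub_rpow_smul_le hxy
    fun t ht => hG t ⟨hax.trans ht.1, ht.2.trans hyb⟩).trans ?_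
  gcongr

theorem norm_caputoRight_half_le {a b : ℝ} {f : ℝ → X} {G : ℝ}
    (hG : ∀ t ∈ Set.Icc a b, ‖derivWithin f (Set.Icc a b) t‖ ≤ G) {x y : ℝ}
    (hay : a ≤ y) (hyx : y ≤ x) (hxb : x ≤ b) :
    ‖caputoRight (1 / 2) a b f x y‖ ≤ 1 / √Real.pi * (2 * √(b - a) * G) := by
  have hG0 : 0 ≤ G := (norm_nonneg _).trans (hG x ⟨hay.trans hyx, hxb⟩)
  rw [caputoRight_half a b f hyx, norm_smul, norm_neg, Real.norm_of_nonneg (by positivity)]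
  gcongr
  refine (norm_integral_rpow_sub_smul_le hyx
    fun t ht => hG t ⟨hay.trans ht.1, ht.2.trans hxb⟩).trans ?_
  gcongr

theorem integral_derivWithin_Icc_sub [CompleteSpace X] {a b : ℝ} (hab : a < b) {f : ℝ → X}
    (hf : ContDiffOn ℝ 1 f (Set.Icc a b)) {x y : ℝ} (hax : a ≤ x) (hxy : x ≤ y) (hyb : y ≤ b) :
    ∫ t in x..y, derivWithin f (Set.Icc a b) t = f y - f x := by
  have hsub : Set.Icc x y ⊆ Set.Icc a b := Set.Icc_subset_Icc hax hyb
  have hc := (hf.continuousOn_derivWithin (uniqueDiffOn_Icc hab) le_rfl).mono hsub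
  refine intervalIntegral.integral_eq_sub_of_hasDerivAt_of_le hxy (hf.continuousOn.mono hsub)
    (fun t ht => ?_) (hc.intervalIntegrable_of_Icc hxy)
  have ht' : t ∈ Set.Ioo a b := ⟨hax.trans_lt ht.1, ht.2.trans_le hyb⟩
  exact ((hf.differentiableOn one_ne_zero t (Set.Ioo_subset_Icc_self ht')).hasDerivWithinAt).hasDerivAt
    (Icc_mem_nhds ht'.1 ht'.2)

theorem inv_sqrt_pi_mul_self : 1 / √Real.pi * (1 / √Real.pi) * Real.pi = 1 := by
  rw [div_mul_div_comm, Real.mul_self_sqrt Real.pi_pos.le]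
  have := Real.pi_pos.ne'
  field_simp

/-- Fractional Taylor formula for the left Caputo derivative of order one half. -/
theorem sub_eq_integral_caputoLeft_half [CompleteSpace X] {a b : ℝ} (hab : a < b) {f : ℝ → X}
    (hf : ContDiffOn ℝ 1 f (Set.Icc a b)) {x y : ℝ} (hax : a ≤ x) (hxy : x ≤ y) (hyb : y ≤ b) :
    f y - f x = (1 / √Real.pi) •
      ∫ t in x..y, (y - t) ^ (-(1 / 2) : ℝ) • caputoLeft (1 / 2) a b f x t := by
  have hc := (hf.continuousOn_derivWithin (uniqueDiffOn_Icc hab) le_rfl).mono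
    (Set.Icc_subset_Icc hax hyb)
  have e : ∫ t in x..y, (y - t) ^ (-(1 / 2) : ℝ) • caputoLeft (1 / 2) a b f x t =
      (1 / √Real.pi) • ∫ t in x..y, (y - t) ^ (-(1 / 2) : ℝ) •
        ∫ s in x..t, (t - s) ^ (-(1 / 2) : ℝ) • derivWithin f (Set.Icc a b) s := by
    rw [← intervalIntegral.integral_smul]
    refine intervalIntegral.integral_congr fun t ht => ?_
    rw [Set.uIcc_of_le hxy] at ht
    rw [caputoLeft_half a b f ht.1, smul_comm]
  rw [e, integral_abel_left hxy (hc.integrableOn_Icc.mono_set Set.Ioc_subset_Icc_self),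
    integral_derivWithin_Icc_sub hab hf hax hxy hyb, smul_smul, smul_smul,
    inv_sqrt_pi_mul_self, one_smul]

/-- Fractional Taylor formula for the right Caputo derivative of order one half. -/
theorem sub_eq_integral_caputoRight_half [CompleteSpace X] {a b : ℝ} (hab : a < b) {f : ℝ → X}
    (hf : ContDiffOn ℝ 1 f (Set.Icc a b)) {x y : ℝ} (hay : a ≤ y) (hyx : y ≤ x) (hxb : x ≤ b) :
    f y - f x = (1 / √Real.pi) •
      ∫ z in y..x, (z - y) ^ (-(1 / 2) : ℝ) • caputoRight (1 / 2) a b f x z := by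
  have hc := (hf.continuousOn_derivWithin (uniqueDiffOn_Icc hab) le_rfl).mono
    (Set.Icc_subset_Icc hay hxb)
  have e : ∫ z in y..x, (z - y) ^ (-(1 / 2) : ℝ) • caputoRight (1 / 2) a b f x z =
      (-(1 / √Real.pi)) • ∫ z in y..x, (z - y) ^ (-(1 / 2) : ℝ) •
        ∫ w in z..x, (w - z) ^ (-(1 / 2) : ℝ) • derivWithin f (Set.Icc a b) w := by
    rw [← intervalIntegral.integral_smul]
    refine intervalIntegral.integral_congr fun t ht => ?_
    rw [Set.uIcc_of_le hyx] at ht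
    rw [caputoRight_half a b f ht.2, smul_comm]
  -- The minus sign in the right derivative turns `f x - f y` into `f y - f x`.
  rw [e, integral_abel_right hyx hc.integrableOn_Icc,
    integral_derivWithin_Icc_sub hab hf hay hyx hxb, smul_smul, smul_smul,
    mul_neg, neg_mul, inv_sqrt_pi_mul_self, neg_one_smul, neg_sub]

/-- Only values between `x` and `y` enter, so `M` may be local for near nodes and global for far
ones. The 2 comes from `∫ (y-t)^(-1/2) dt = 2√(y-x)`. -/
theorem norm_sub_le_of_caputoLeft_le [CompleteSpace X] {a b : ℝ} (hab : a < b) {f : ℝ → X}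
    (hf : ContDiffOn ℝ 1 f (Set.Icc a b)) {x y M : ℝ} (hax : a ≤ x) (hxy : x ≤ y) (hyb : y ≤ b)
    (hM : ∀ t ∈ Set.Icc x y, ‖caputoLeft (1 / 2) a b f x t‖ ≤ M) :
    ‖f y - f x‖ ≤ 2 / √Real.pi * (M * √(y - x)) := by
  rw [sub_eq_integral_caputoLeft_half hab hf hax hxy hyb, norm_smul,
    Real.norm_of_nonneg (by positivity)]
  calc _ ≤ 1 / √Real.pi * (2 * √(y - x) * M) := by
        gcongr; exact norm_integral_sub_rpow_smul_le hxy hM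
    _ = _ := by ring

theorem norm_sub_le_of_caputoRight_le [CompleteSpace X] {a b : ℝ} (hab : a < b) {f : ℝ → X}
    (hf : ContDiffOn ℝ 1 f (Set.Icc a b)) {x y M : ℝ} (hay : a ≤ y) (hyx : y ≤ x) (hxb : x ≤ b)
    (hM : ∀ z ∈ Set.Icc y x, ‖caputoRight (1 / 2) a b f x z‖ ≤ M) :
    ‖f y - f x‖ ≤ 2 / √Real.pi * (M * √(x - y)) := by
  rw [sub_eq_integral_caputoRight_half hab hf hay hyx hxb, norm_smul,
    Real.norm_of_nonneg (by positivity)]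
  calc _ ≤ 1 / √Real.pi * (2 * √(x - y) * M) := by
        gcongr; exact norm_integral_rpow_sub_smul_le hyx hM
    _ = _ := by ring

end Caputo

/-! ### Modulus of continuity and sup norm in `[0, ∞]`. -/

section Modulus

variable {X : Type*} [NormedAddCommGroup X]

theorem enorm_le_supNorm (g : ℝ → X) {S : Set ℝ} {y : ℝ} (hy : y ∈ S) :
    ‖g y‖ₑ ≤ supNorm g S :=
  le_iSup₂ (f := fun y (_ : y ∈ S) => ‖g y‖ₑ) y hy

theorem enorm_sub_le_modulus (g : ℝ → X) {δ : ℝ} {S : Set ℝ} {y z : ℝ} (hy : y ∈ S) (hz : z ∈ S)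
    (h : |y - z| ≤ δ) : ‖g y - g z‖ₑ ≤ modulus g δ S := by
  unfold modulus
  exact le_iSup₂_of_le y hy (le_iSup₂_of_le z hz (le_iSup_of_le h le_rfl))

theorem supNorm_le_ofReal {g : ℝ → X} {S : Set ℝ} {B : ℝ} (hB : ∀ y ∈ S, ‖g y‖ ≤ B) :
    supNorm g S ≤ ENNReal.ofReal B := by
  refine iSup₂_le fun y hy => ?_
  rw [← ofReal_norm]
  exact ENNReal.ofReal_le_ofReal (hB y hy)

theorem modulus_le_two_mul_supNorm (g : ℝ → X) (δ : ℝ) (S : Set ℝ) :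
    modulus g δ S ≤ 2 * supNorm g S := by
  refine iSup₂_le fun y hy => iSup₂_le fun z hz => iSup_le fun _ => ?_
  rw [two_mul]
  exact enorm_sub_le.trans (add_le_add (enorm_le_supNorm g hy) (enorm_le_supNorm g hz))

theorem norm_le_toReal_of_enorm_le {v : X} {c : ℝ≥0∞} (hc : c ≠ ∞) (h : ‖v‖ₑ ≤ c) :
    ‖v‖ ≤ c.toReal := by
  rw [← toReal_enorm]
  exact ENNReal.toReal_mono hc h

end Modulus

/-! ### Error of the network operator. -/

section NetOp

variable {X : Type*} [NormedAddCommGroup X] [NormedSpace ℝ X]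

/-- Error bound for the network operator from a near bound `W` and two one-sided far bounds. -/
theorem norm_netOp_sub_le {m : ℕ} (hm : 1 ≤ m) {a b : ℝ} {n : ℕ} {f : ℝ → X} {x : ℝ}
    (hx : x ∈ Set.Icc a b) (hab_n : ⌈(n : ℝ) * a⌉ ≤ ⌊(n : ℝ) * b⌋) {N W L R : ℝ} (hN : 2 < N)
    (hW : 0 ≤ W) (hL : 0 ≤ L) (hR : 0 ≤ R)
    (h : ∀ k ∈ Finset.Icc ⌈(n : ℝ) * a⌉ ⌊(n : ℝ) * b⌋, ‖f ((k : ℤ) / n) - f x‖ ≤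
      W + (if N < n * x - k then L else 0) + (if N < k - n * x then R else 0)) :
    ‖netOp m a b n f x - f x‖ ≤ 2 * (1 + 4 ^ m : ℝ) ^ (1 / (2 * (m : ℝ))) *
      (W + 1 / (4 * m * (N - 2) ^ (2 * m)) * (L + R)) := by
  set I := Finset.Icc ⌈(n : ℝ) * a⌉ ⌊(n : ℝ) * b⌋ with hI
  set V := ∑ k ∈ I, density m ((n : ℝ) * x - k) with hV
  set τ := 1 / (4 * (m : ℝ) * (N - 2) ^ (2 * m))
  set C := 2 * (1 + 4 ^ m : ℝ) ^ (1 / (2 * (m : ℝ))) with hC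
  have hC0 : 0 < C := by positivity
  have hτ : 0 ≤ τ := tail_nonneg hN
  have hVC : 1 / C ≤ V := by
    have h1 := mul_le_mul_of_nonneg_left hx.1 (Nat.cast_nonneg (α := ℝ) n)
    have h2 := mul_le_mul_of_nonneg_left hx.2 (Nat.cast_nonneg (α := ℝ) n)
    exact le_sum_density hm hab_n (by linarith [Int.ceil_lt_add_one ((n : ℝ) * a)])
      (by linarith [Int.lt_floor_add_one ((n : ℝ) * b)])
  have hV0 : 0 < V := (by positivity : 0 < 1 / C).trans_le hVC
  have hVC' : V⁻¹ ≤ C := by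
    rw [inv_le_comm₀ hV0 hC0, ← one_div]; exact hVC
  -- The normalized weights sum to 1, so `f x` can be moved inside the average.
  have e : netOp m a b n f x - f x =
      V⁻¹ • ∑ k ∈ I, density m ((n : ℝ) * x - k) • (f ((k : ℤ) / n) - f x) := by
    simp only [smul_sub, Finset.sum_sub_distrib]
    rw [← Finset.sum_smul, ← hV, smul_smul, inv_mul_cancel₀ hV0.ne', one_smul, netOp]
  have hsum : ‖∑ k ∈ I, density m ((n : ℝ) * x - k) • (f ((k : ℤ) / n) - f x)‖ ≤
      W + τ * (L + R) := by
    calc _ ≤ ∑ k ∈ I, (density m ((n : ℝ) * x - k) * W +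
          (if N < n * x - k then density m ((n : ℝ) * x - k) else 0) * L +
          (if N < k - n * x then density m ((n : ℝ) * x - k) else 0) * R) := by
          refine norm_sum_le_of_le I fun k hk => ?_
          rw [norm_smul, Real.norm_of_nonneg (density_nonneg hm _)]
          refine (mul_le_mul_of_nonneg_left (h k hk) (density_nonneg hm _)).trans (le_of_eq ?_)
          split_ifs <;> ring
      _ = V * W + (∑ k ∈ I with N < n * x - (k : ℤ), density m ((n : ℝ) * x - k)) * L +
          (∑ k ∈ I with N < (k : ℤ) - n * x, density m ((n : ℝ) * x - k)) * R := by
          rw [Finset.sum_add_distrib, Finset.sum_add_distrib, ← Finset.sum_mul, ← Finset.sum_mul,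
            ← Finset.sum_mul, Finset.sum_filter, Finset.sum_filter]
      _ ≤ 1 * W + τ * L + τ * R := by
          gcongr
          · exact sum_density_le_one hm _ _ _
          · exact sum_density_left_tail_le hm _ _ _ hN
          · exact sum_density_right_tail_le hm _ _ _ hN
      _ = _ := by ring
  rw [e, norm_smul, Real.norm_of_nonneg (by positivity)]
  gcongr

variable [CompleteSpace X]

theorem norm_netOp_sub_le_caputo {a b : ℝ} (hab : a < b) {f : ℝ → X}
    (hf : ContDiffOn ℝ 1 f (Set.Icc a b)) {β : ℝ} {m : ℕ} (hm : 1 ≤ m)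
    {n : ℕ} (hn : 2 < (n : ℝ) ^ (1 - β)) (hab_n : ⌈(n : ℝ) * a⌉ ≤ ⌊(n : ℝ) * b⌋) (hn0 : 0 < n)
    {x : ℝ} (hx : x ∈ Set.Icc a b) {wr wl sr sl : ℝ}
    (hwr0 : 0 ≤ wr) (hwl0 : 0 ≤ wl) (hsr0 : 0 ≤ sr) (hsl0 : 0 ≤ sl)
    (hwr : ∀ z ∈ Set.Icc a x, |z - x| ≤ 1 / (n : ℝ) ^ β → ‖caputoRight (1 / 2) a b f x z‖ ≤ wr)
    (hwl : ∀ z ∈ Set.Icc x b, |z - x| ≤ 1 / (n : ℝ) ^ β → ‖caputoLeft (1 / 2) a b f x z‖ ≤ wl)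
    (hsr : ∀ z ∈ Set.Icc a x, ‖caputoRight (1 / 2) a b f x z‖ ≤ sr)
    (hsl : ∀ z ∈ Set.Icc x b, ‖caputoLeft (1 / 2) a b f x z‖ ≤ sl) :
    ‖netOp m a b n f x - f x‖ ≤
      4 * (1 + 4 ^ m : ℝ) ^ (1 / (2 * (m : ℝ))) / √Real.pi *
        ((wr + wl) / (n : ℝ) ^ (β / 2) +
          1 / (4 * (m : ℝ) * ((n : ℝ) ^ (1 - β) - 2) ^ (2 * m)) *
            (sr * √(x - a) + sl * √(b - x))) := by
  have hn' : (0 : ℝ) < n := by exact_mod_cast hn0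
  -- Rescaling by `n`: the tail condition `|nx - k| > n^(1-β)` is `|x - k/n| > n^(-β)`.
  have hδ : (n : ℝ) ^ (1 - β) = n * (1 / (n : ℝ) ^ β) := by
    rw [Real.rpow_sub hn', Real.rpow_one]; ring
  have hsq : √(1 / (n : ℝ) ^ β) = 1 / (n : ℝ) ^ (β / 2) := by
    rw [Real.sqrt_div zero_le_one, Real.sqrt_one, Real.sqrt_eq_rpow, ← Real.rpow_mul hn'.le]
    congr 2; ring
  set P := 2 / √Real.pi with hP
  have hP0 : 0 < P := by positivity
  -- A near node may lie on either side of `x`, so the common bound `W` uses `wr + wl`; the far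
  -- bounds stay one-sided.
  have main := norm_netOp_sub_le hm hx hab_n (f := f) hn (W := P * ((wr + wl) / (n : ℝ) ^ (β / 2)))
    (L := P * (sr * √(x - a))) (R := P * (sl * √(b - x)))
    (by positivity) (by positivity) (by positivity) fun k hk => ?_
  · refine main.trans (le_of_eq ?_)
    rw [hP]; ring
  rw [Finset.mem_Icc, Int.ceil_le, Int.le_floor] at hk
  set u : ℝ := (k : ℝ) / n with hu
  have hku : (k : ℝ) = n * u := by rw [hu]; field_simp
  have hau : a ≤ u := by rw [hu, le_div_iff₀ hn']; linarith [hk.1]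
  have hub : u ≤ b := by rw [hu, div_le_iff₀ hn']; linarith [hk.2]
  rw [hku, ← mul_sub, ← mul_sub, hδ]
  simp only [mul_lt_mul_iff_right₀ hn']
  have hδ0 : 0 < 1 / (n : ℝ) ^ β := by positivity
  have near : ∀ {d w : ℝ}, 0 ≤ w → w ≤ wr + wl → d ≤ 1 / (n : ℝ) ^ β →
      P * (w * √d) ≤ P * ((wr + wl) / (n : ℝ) ^ (β / 2)) := by
    intro d w hw0 hw hd
    have : √d ≤ 1 / (n : ℝ) ^ (β / 2) := hsq ▸ Real.sqrt_le_sqrt hd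
    calc P * (w * √d) ≤ P * ((wr + wl) * (1 / (n : ℝ) ^ (β / 2))) := by gcongr
      _ = _ := by ring
  have hW0 : 0 ≤ P * ((wr + wl) / (n : ℝ) ^ (β / 2)) := by positivity
  rcases le_total u x with hux | hxu
  · rw [if_neg (show ¬ 1 / (n : ℝ) ^ β < u - x by linarith), add_zero]
    split_ifs with hfar
    · refine (norm_sub_le_of_caputoRight_le hab hf hau hux hx.2
        fun z hz => hsr z ⟨hau.trans hz.1, hz.2⟩).trans ?_
      have : P * (sr * √(x - u)) ≤ P * (sr * √(x - a)) := by gcongr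
      linarith
    · rw [add_zero]
      refine (norm_sub_le_of_caputoRight_le hab hf hau hux hx.2
        fun z hz => hwr z ⟨hau.trans hz.1, hz.2⟩ ?_).trans
          (near hwr0 (by linarith) (not_lt.1 hfar))
      rw [abs_of_nonpos (by linarith [hz.2])]
      linarith [hz.1]
  · rw [if_neg (show ¬ 1 / (n : ℝ) ^ β < x - u by linarith), add_zero]
    split_ifs with hfar
    · refine (norm_sub_le_of_caputoLeft_le hab hf hx.1 hxu hub
        fun z hz => hsl z ⟨hz.1, hz.2.trans hub⟩).trans ?_
      have : P * (sl * √(u - x)) ≤ P * (sl * √(b - x)) := by gcongr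
      linarith
    · rw [add_zero]
      refine (norm_sub_le_of_caputoLeft_le hab hf hx.1 hxu hub
        fun z hz => hwl z ⟨hz.1, hz.2.trans hub⟩ ?_).trans
          (near hwl0 (by linarith) (not_lt.1 hfar))
      rw [abs_of_nonneg (by linarith [hz.1])]
      linarith [hz.2]

end NetOp

/-- `f'` is continuous on a compact interval, and the kernel integrals are at most `2√(b-a)`, so one
bound serves all base points. -/
theorem exists_supNorm_caputo_le {X : Type*} [NormedAddCommGroup X] [NormedSpace ℝ X]
    {a b : ℝ} (hab : a < b) {f : ℝ → X} (hf : ContDiffOn ℝ 1 f (Set.Icc a b)) :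
    ∃ B : ℝ, ∀ x ∈ Set.Icc a b,
      supNorm (caputoRight (1 / 2) a b f x) (Set.Icc a x) ≤ ENNReal.ofReal B ∧
      supNorm (caputoLeft (1 / 2) a b f x) (Set.Icc x b) ≤ ENNReal.ofReal B := by
  obtain ⟨G, hG⟩ := isCompact_Icc.exists_bound_of_continuousOn
    (hf.continuousOn_derivWithin (uniqueDiffOn_Icc hab) le_rfl)
  exact ⟨_, fun x hx => ⟨supNorm_le_ofReal fun y hy => norm_caputoRight_half_le hG hy.1 hy.2 hx.2,
    supNorm_le_ofReal fun y hy => norm_caputoLeft_half_le hG hx.1 hy.1 hy.2⟩⟩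

end NeuralFrac

/-! ### Passage to `[0, ∞]` and the final theorem. -/

namespace NeuralFrac

theorem enorm_netOp_sub_le {X : Type*} [NormedAddCommGroup X] [NormedSpace ℝ X] [CompleteSpace X]
    {a b : ℝ} (hab : a < b) {f : ℝ → X} (hf : ContDiffOn ℝ 1 f (Set.Icc a b)) {β : ℝ}
    {m : ℕ} (hm : 1 ≤ m) {n : ℕ} (hn : 2 < (n : ℝ) ^ (1 - β))
    (hab_n : ⌈(n : ℝ) * a⌉ ≤ ⌊(n : ℝ) * b⌋) (hn0 : 0 < n) {x : ℝ} (hx : x ∈ Set.Icc a b)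
    (hR : supNorm (caputoRight (1 / 2) a b f x) (Set.Icc a x) ≠ ∞)
    (hL : supNorm (caputoLeft (1 / 2) a b f x) (Set.Icc x b) ≠ ∞) :
    ‖netOp m a b n f x - f x‖ₑ ≤
      ENNReal.ofReal (4 * (1 + 4 ^ m : ℝ) ^ (1 / (2 * (m : ℝ))) / √Real.pi) *
        ((modulus (caputoRight (1 / 2) a b f x) (1 / (n : ℝ) ^ β) (Set.Icc a x) +
            modulus (caputoLeft (1 / 2) a b f x) (1 / (n : ℝ) ^ β) (Set.Icc x b)) /
            ENNReal.ofReal ((n : ℝ) ^ (β / 2)) +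
          ENNReal.ofReal (1 / (4 * (m : ℝ) * ((n : ℝ) ^ (1 - β) - 2) ^ (2 * m))) *
            (supNorm (caputoRight (1 / 2) a b f x) (Set.Icc a x) * ENNReal.ofReal √(x - a) +
              supNorm (caputoLeft (1 / 2) a b f x) (Set.Icc x b) * ENNReal.ofReal √(b - x))) := by
  have hn' : (0 : ℝ) < n := by exact_mod_cast hn0
  set sR := supNorm (caputoRight (1 / 2) a b f x) (Set.Icc a x) with hsR
  set sL := supNorm (caputoLeft (1 / 2) a b f x) (Set.Icc x b) with hsL
  set wR := modulus (caputoRight (1 / 2) a b f x) (1 / (n : ℝ) ^ β) (Set.Icc a x) with hwR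
  set wL := modulus (caputoLeft (1 / 2) a b f x) (1 / (n : ℝ) ^ β) (Set.Icc x b) with hwL
  -- Finiteness is essential before using `toReal`, which sends `∞` to 0.
  have hwR' : wR ≠ ∞ := ne_top_of_le_ne_top (ENNReal.mul_ne_top (by simp) hR)
    (modulus_le_two_mul_supNorm _ _ _)
  have hwL' : wL ≠ ∞ := ne_top_of_le_ne_top (ENNReal.mul_ne_top (by simp) hL)
    (modulus_le_two_mul_supNorm _ _ _)
  have h := norm_netOp_sub_le_caputo hab hf hm hn hab_n hn0 hx
    (wr := wR.toReal) (wl := wL.toReal) (sr := sR.toReal) (sl := sL.toReal)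
    ENNReal.toReal_nonneg ENNReal.toReal_nonneg ENNReal.toReal_nonneg ENNReal.toReal_nonneg
    (fun z hz hd => norm_le_toReal_of_enorm_le hwR' <| by
      simpa only [caputoRight_half_self, sub_zero] using
        enorm_sub_le_modulus (caputoRight (1 / 2) a b f x) hz ⟨hx.1, le_rfl⟩ hd)
    (fun z hz hd => norm_le_toReal_of_enorm_le hwL' <| by
      simpa only [caputoLeft_half_self, sub_zero] using
        enorm_sub_le_modulus (caputoLeft (1 / 2) a b f x) hz ⟨le_rfl, hx.2⟩ hd)
    (fun z hz => norm_le_toReal_of_enorm_le hR (enorm_le_supNorm _ hz))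
    (fun z hz => norm_le_toReal_of_enorm_le hL (enorm_le_supNorm _ hz))
  have hτ := tail_nonneg (m := m) hn
  have hpow : 0 < (n : ℝ) ^ (β / 2) := by positivity
  rw [← ofReal_norm]
  refine (ENNReal.ofReal_le_ofReal h).trans (le_of_eq ?_)
  rw [ENNReal.ofReal_mul (by positivity), ENNReal.ofReal_add (by positivity) (by positivity),
    ENNReal.ofReal_div_of_pos hpow, ENNReal.ofReal_add (by positivity) (by positivity),
    ENNReal.ofReal_mul hτ, ENNReal.ofReal_add (by positivity) (by positivity),
    ENNReal.ofReal_mul ENNReal.toReal_nonneg, ENNReal.ofReal_mul ENNReal.toReal_nonneg,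
    ENNReal.ofReal_toReal hR, ENNReal.ofReal_toReal hL, ENNReal.ofReal_toReal hwR',
    ENNReal.ofReal_toReal hwL']

end NeuralFrac

theorem corollary32 {X : Type*} [NormedAddCommGroup X] [NormedSpace ℝ X] [CompleteSpace X]
    (a b : ℝ) (hab : a < b) (f : ℝ → X) (hf : ContDiffOn ℝ 1 f (Set.Icc a b))
    (β : ℝ) (hβ0 : 0 < β) (hβ1 : β < 1) (m : ℕ) (hm : 1 ≤ m)
    (n : ℕ) (hn : 2 < (n : ℝ) ^ (1 - β)) (hab_n : ⌈(n : ℝ) * a⌉ ≤ ⌊(n : ℝ) * b⌋) :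
    (∀ x ∈ Set.Icc a b,
      ‖NeuralFrac.netOp m a b n f x - f x‖ₑ ≤
        ENNReal.ofReal (4 * (1 + 4 ^ m : ℝ) ^ (1 / (2 * (m : ℝ))) / √Real.pi) *
          ((NeuralFrac.modulus (NeuralFrac.caputoRight (1 / 2) a b f x)
                (1 / (n : ℝ) ^ β) (Set.Icc a x) +
              NeuralFrac.modulus (NeuralFrac.caputoLeft (1 / 2) a b f x)
                (1 / (n : ℝ) ^ β) (Set.Icc x b)) /
              ENNReal.ofReal ((n : ℝ) ^ (β / 2)) +
            ENNReal.ofReal (1 / (4 * (m : ℝ) * ((n : ℝ) ^ (1 - β) - 2) ^ (2 * m))) *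
              (NeuralFrac.supNorm (NeuralFrac.caputoRight (1 / 2) a b f x) (Set.Icc a x) *
                  ENNReal.ofReal √(x - a) +
                NeuralFrac.supNorm (NeuralFrac.caputoLeft (1 / 2) a b f x) (Set.Icc x b) *
                  ENNReal.ofReal √(b - x)))) ∧
    NeuralFrac.supNorm (fun x => NeuralFrac.netOp m a b n f x - f x) (Set.Icc a b) ≤
      ENNReal.ofReal (4 * (1 + 4 ^ m : ℝ) ^ (1 / (2 * (m : ℝ))) / √Real.pi) *
        (((⨆ x ∈ Set.Icc a b, NeuralFrac.modulus (NeuralFrac.caputoRight (1 / 2) a b f x)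
                (1 / (n : ℝ) ^ β) (Set.Icc a x)) +
            (⨆ x ∈ Set.Icc a b, NeuralFrac.modulus (NeuralFrac.caputoLeft (1 / 2) a b f x)
                (1 / (n : ℝ) ^ β) (Set.Icc x b))) /
            ENNReal.ofReal ((n : ℝ) ^ (β / 2)) +
          ENNReal.ofReal (√(b - a) / (4 * (m : ℝ) * ((n : ℝ) ^ (1 - β) - 2) ^ (2 * m))) *
            ((⨆ x ∈ Set.Icc a b,
                NeuralFrac.supNorm (NeuralFrac.caputoRight (1 / 2) a b f x) (Set.Icc a x)) +
              (⨆ x ∈ Set.Icc a b,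
                NeuralFrac.supNorm (NeuralFrac.caputoLeft (1 / 2) a b f x) (Set.Icc x b)))) ∧
    ENNReal.ofReal (4 * (1 + 4 ^ m : ℝ) ^ (1 / (2 * (m : ℝ))) / √Real.pi) *
        (((⨆ x ∈ Set.Icc a b, NeuralFrac.modulus (NeuralFrac.caputoRight (1 / 2) a b f x)
                (1 / (n : ℝ) ^ β) (Set.Icc a x)) +
            (⨆ x ∈ Set.Icc a b, NeuralFrac.modulus (NeuralFrac.caputoLeft (1 / 2) a b f x)
                (1 / (n : ℝ) ^ β) (Set.Icc x b))) /
            ENNReal.ofReal ((n : ℝ) ^ (β / 2)) +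
          ENNReal.ofReal (√(b - a) / (4 * (m : ℝ) * ((n : ℝ) ^ (1 - β) - 2) ^ (2 * m))) *
            ((⨆ x ∈ Set.Icc a b,
                NeuralFrac.supNorm (NeuralFrac.caputoRight (1 / 2) a b f x) (Set.Icc a x)) +
              (⨆ x ∈ Set.Icc a b,
                NeuralFrac.supNorm (NeuralFrac.caputoLeft (1 / 2) a b f x) (Set.Icc x b)))) < ∞ := by
  -- As `1 - β ≠ 0`, the power is 0 at `n = 0`, contradicting `hn`.
  have hn0 : 0 < n := by
    rcases Nat.eq_zero_or_pos n with rfl | h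
    · rw [Nat.cast_zero, Real.zero_rpow (by linarith)] at hn
      norm_num at hn
    · exact h
  obtain ⟨B, hB⟩ := NeuralFrac.exists_supNorm_caputo_le hab hf
  have pointwise := fun x hx => NeuralFrac.enorm_netOp_sub_le hab hf hm hn hab_n hn0 hx
    (ne_top_of_le_ne_top ENNReal.ofReal_ne_top (hB x hx).1)
    (ne_top_of_le_ne_top ENNReal.ofReal_ne_top (hB x hx).2)
  refine ⟨pointwise, ?_, ?_⟩
  · refine iSup₂_le fun x hx => (pointwise x hx).trans ?_
    have hN : 0 < (n : ℝ) ^ (1 - β) - 2 := by linarith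
    -- Moving `√(b-a)` into the bracket lets it be compared termwise with `√(x-a)` and `√(b-x)`.
    have hsplit : √(b - a) / (4 * (m : ℝ) * ((n : ℝ) ^ (1 - β) - 2) ^ (2 * m)) =
        1 / (4 * (m : ℝ) * ((n : ℝ) ^ (1 - β) - 2) ^ (2 * m)) * √(b - a) := by ring
    rw [hsplit, ENNReal.ofReal_mul (NeuralFrac.tail_nonneg hn), mul_assoc (ENNReal.ofReal _)
      (ENNReal.ofReal √(b - a)), mul_add (ENNReal.ofReal √(b - a)),
      mul_comm (ENNReal.ofReal √(b - a)), mul_comm (ENNReal.ofReal √(b - a))]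
    gcongr
    · exact le_iSup₂ (f := fun x (_ : x ∈ Set.Icc a b) => NeuralFrac.modulus
        (NeuralFrac.caputoRight (1 / 2) a b f x) (1 / (n : ℝ) ^ β) (Set.Icc a x)) x hx
    · exact le_iSup₂ (f := fun x (_ : x ∈ Set.Icc a b) => NeuralFrac.modulus
        (NeuralFrac.caputoLeft (1 / 2) a b f x) (1 / (n : ℝ) ^ β) (Set.Icc x b)) x hx
    · exact le_iSup₂ (f := fun x (_ : x ∈ Set.Icc a b) => NeuralFrac.supNorm
        (NeuralFrac.caputoRight (1 / 2) a b f x) (Set.Icc a x)) x hx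
    · exact hx.2
    · exact le_iSup₂ (f := fun x (_ : x ∈ Set.Icc a b) => NeuralFrac.supNorm
        (NeuralFrac.caputoLeft (1 / 2) a b f x) (Set.Icc x b)) x hx
    · exact hx.1
  · have hBtop : ENNReal.ofReal B < ∞ := ENNReal.ofReal_lt_top
    have hBtop2 : 2 * ENNReal.ofReal B < ∞ := ENNReal.mul_lt_top (by simp) hBtop
    refine ENNReal.mul_lt_top ENNReal.ofReal_lt_top (ENNReal.add_lt_top.2
      ⟨ENNReal.div_lt_top (ENNReal.add_lt_top.2 ⟨?_, ?_⟩).ne ?_,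
        ENNReal.mul_lt_top ENNReal.ofReal_lt_top (ENNReal.add_lt_top.2 ⟨?_, ?_⟩)⟩)
    · refine lt_of_le_of_lt (iSup₂_le fun x hx => ?_) hBtop2
      exact (NeuralFrac.modulus_le_two_mul_supNorm _ _ _).trans (by gcongr; exact (hB x hx).1)
    · refine lt_of_le_of_lt (iSup₂_le fun x hx => ?_) hBtop2
      exact (NeuralFrac.modulus_le_two_mul_supNorm _ _ _).trans (by gcongr; exact (hB x hx).2)
    · rw [Ne, ENNReal.ofReal_eq_zero, not_le]
      have : (0 : ℝ) < n := by exact_mod_cast hn0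
      positivity
    · exact lt_of_le_of_lt (iSup₂_le fun x hx => (hB x hx).1) hBtop
    · exact lt_of_le_of_lt (iSup₂_le fun x hx => (hB x hx).2) hBtop
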